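/- A box in $\mathbb{R}^d$ is a closed axis-parallel cuboid $[a_1,b_1]\times\cdots\times[a_d,b_d]$ with $a_i<b_i$ for all $i$. Two boxes in $\mathbb{R}^d$ are $k$-neighborly if their intersection is nonempty and has dimension at least $d-k$ and at most $d-1$. Let $n(k,d)$ denote the maximum number of boxes in a family of pairwise $k$-neighborly boxes in $\mathbb{R}^d$. Let $s$ and $d$ be positive integers with $s\le d/2$. Then $$\left(\frac12+\frac1{2^{s+1}}\right)2^d-o(2^d)\;\le\; n(d-s,d)\;\le\;\left(\frac12+\frac1{2^{s+1}}\right)2^d,$$ where the term $o(2^d)$ refers to $d\to\infty$ with $s$ fixed. In consequence, for every fixed positive integer $s$, $$\lim_{d\to\infty}\frac{n(d-s,d)}{2^d}=\frac{2^s+1}{2^{s+1}}.$$ -/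

import Mathlib

open Filter Asymptotics Topology

namespace NeighborlyBoxes

/-- A box in `ℝ^d`: a closed axis-parallel cuboid `[a₁, b₁] × ⋯ × [a_d, b_d]` of full dimension,
that is, with `aᵢ < bᵢ` for all `i`. -/
def IsBox {d : ℕ} (A : Set (Fin d → ℝ)) : Prop :=
  ∃ a b : Fin d → ℝ, (∀ i, a i < b i) ∧ A = Set.Icc a b

/-- The (affine) dimension of a nonempty subset of `ℝ^d`. -/
noncomputable def affDim {d : ℕ} (A : Set (Fin d → ℝ)) : ℕ :=
  Module.finrank ℝ (vectorSpan ℝ A)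

/-- Two boxes are `k`-neighborly if they meet and `d - k ≤ dim (A ∩ B) ≤ d - 1`
(the two inequalities are written without subtraction). -/
def Neighborly {d : ℕ} (k : ℕ) (A B : Set (Fin d → ℝ)) : Prop :=
  (A ∩ B).Nonempty ∧ affDim (A ∩ B) < d ∧ d ≤ affDim (A ∩ B) + k

/-- A finite family of boxes in `ℝ^d`, any two distinct members of which are `k`-neighborly. -/
def IsNeighborlyFamily (k d : ℕ) (F : Finset (Set (Fin d → ℝ))) : Prop :=
  (∀ A ∈ F, IsBox A) ∧ ∀ A ∈ F, ∀ B ∈ F, A ≠ B → Neighborly k A B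

/-- The possible sizes of families of pairwise `k`-neighborly boxes in `ℝ^d`. -/
def sizes (k d : ℕ) : Set ℕ :=
  {m | ∃ F : Finset (Set (Fin d → ℝ)), IsNeighborlyFamily k d F ∧ F.card = m}

/-- `n k d` is the maximum size of a family of pairwise `k`-neighborly boxes in `ℝ^d`. -/
noncomputable def n (k d : ℕ) : ℕ := sSup (sizes k d)

end NeighborlyBoxes

/-! Pairwise intersecting boxes share a point. Recording, in each coordinate, whether that point is
a left end, a right end or interior turns the family into words over `{0, 1, *}`, any two of which
conflict in between 1 and k places; the passage is reversible. Upper bound (`card_words_le`): a word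
with j stars is a subcube with 2^j points, and these subcubes are disjoint. Give each point of such
a subcube mass 2^(-j). If antipodal points lie in subcubes with j and l stars, having at most d - s
conflicts forces j + l ≥ s, so the two masses add up to at most 1 + 2^(-s). Sum over the cube. Lower
bound (`card_ball_add_card_mem_sizes`): a Hamming ball of radius about (d - s)/2 gives about 2^d/2
words without stars, and words with the same s stars lying outside it add about 2^(d-s)/2. The loss
is a bounded number of middle binomial coefficients, each o(2^d). -/

namespace NeighborlyBoxes

/-! ### Translation between boxes and words. -/

/-- The dimension of a nonempty closed cuboid is its number of nondegenerate sides. -/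
theorem affDim_Icc {d : ℕ} {a b : Fin d → ℝ} (hab : a ≤ b) :
    affDim (Set.Icc a b) = (Finset.univ.filter fun i => a i < b i).card := by
  classical
  have hspan : vectorSpan ℝ (Set.Icc a b) =
      Submodule.span ℝ (Set.range fun i : {i // a i < b i} => Pi.single (M := fun _ => ℝ) i.1 1) := by
    apply le_antisymm
    · rw [vectorSpan_def, Submodule.span_le]
      rintro _ ⟨x, hx, y, hy, rfl⟩
      have hsum : x -ᵥ y = ∑ i, (x i - y i) • Pi.single (M := fun _ => ℝ) i (1 : ℝ) := by
        ext j
        simp [Finset.sum_apply, Pi.single_apply]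
      change x -ᵥ y ∈ Submodule.span ℝ _
      rw [hsum]
      refine Submodule.sum_mem _ fun i _ => ?_
      by_cases hi : a i < b i
      · exact Submodule.smul_mem _ _ (Submodule.subset_span ⟨⟨i, hi⟩, rfl⟩)
      · have : x i - y i = 0 := by
          linarith [hx.1 i, hx.2 i, hy.1 i, hy.2 i, hab i]
        rw [this, zero_smul]
        exact Submodule.zero_mem _
    · rw [Submodule.span_le]
      rintro _ ⟨⟨i, hi⟩, rfl⟩
      have hmem : Function.update a i (b i) ∈ Set.Icc a b := by
        refine ⟨fun j => ?_, fun j => ?_⟩ <;> by_cases hj : j = i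
        · subst hj; simpa using hab j
        · simp [hj]
        · subst hj; simp
        · simpa [hj] using hab j
      have h := vsub_mem_vectorSpan ℝ hmem (Set.left_mem_Icc.2 hab)
      have heq : Pi.single (M := fun _ => ℝ) i (1 : ℝ) =
          (b i - a i)⁻¹ • (Function.update a i (b i) -ᵥ a) := by
        have hne : b i - a i ≠ 0 := by linarith
        ext j
        by_cases hj : j = i
        · subst hj; simp [hne]
        · simp [hj]
      change Pi.single (M := fun _ => ℝ) i (1 : ℝ) ∈ vectorSpan ℝ (Set.Icc a b)
      rw [heq]
      exact Submodule.smul_mem _ _ h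
  rw [affDim, hspan, finrank_span_eq_card, Fintype.card_subtype]
  have := (Pi.basisFun ℝ (Fin d)).linearIndependent.comp
    (Subtype.val : {i // a i < b i} → Fin d) Subtype.val_injective
  convert this using 1
  ext i
  simp

/-- The number of coordinates in which two words over `{0, 1, *}` carry opposite letters. -/
def conflicts {d : ℕ} (u v : Fin d → Option Bool) : ℕ :=
  (Finset.univ.filter fun i => ∃ c, u i = some c ∧ v i = some (!c)).card

/-- The position of the point `p` in each side of the cuboid `[a, b]`: `some false` if it is the
right end, `some true` if it is the left end, `none` if it is interior. -/
noncomputable def wordAt {d : ℕ} (p a b : Fin d → ℝ) (i : Fin d) : Option Bool :=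
  if p i = b i then some false else if p i = a i then some true else none

/-- A side of the intersection contains `p i`, so it degenerates exactly when `p i` is the right end
of one interval and the left end of the other. -/
theorem affDim_inter_add_conflicts {d : ℕ} {p a b a' b' : Fin d → ℝ}
    (hab : ∀ i, a i < b i) (hab' : ∀ i, a' i < b' i)
    (hp : p ∈ Set.Icc a b) (hp' : p ∈ Set.Icc a' b') :
    affDim (Set.Icc a b ∩ Set.Icc a' b') + conflicts (wordAt p a b) (wordAt p a' b') = d := by
  classical
  rw [Set.Icc_inter_Icc, affDim_Icc, conflicts]
  · have hcompl : (Finset.univ.filter fun i => ∃ c, wordAt p a b i = some c ∧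
        wordAt p a' b' i = some (!c)) =
        Finset.univ.filter fun i => ¬ (a ⊔ a') i < (b ⊓ b') i := by
      refine Finset.filter_congr fun i _ => ?_
      have h1 := hp.1 i
      have h2 := hp.2 i
      have h3 := hp'.1 i
      have h4 := hp'.2 i
      have h5 := hab i
      have h6 := hab' i
      simp only [wordAt, Bool.exists_bool, Pi.sup_apply, Pi.inf_apply, sup_lt_iff, lt_inf_iff]
      split_ifs <;> simp <;> grind
    rw [hcompl, Finset.card_filter_add_card_filter_not, Finset.card_univ, Fintype.card_fin]
  · exact (sup_le hp.1 hp'.1).trans (le_inf hp.2 hp'.2)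

theorem neighborly_iff_conflicts {d k : ℕ} {p a b a' b' : Fin d → ℝ}
    (hab : ∀ i, a i < b i) (hab' : ∀ i, a' i < b' i)
    (hp : p ∈ Set.Icc a b) (hp' : p ∈ Set.Icc a' b') :
    Neighborly k (Set.Icc a b) (Set.Icc a' b') ↔
      1 ≤ conflicts (wordAt p a b) (wordAt p a' b') ∧
        conflicts (wordAt p a b) (wordAt p a' b') ≤ k := by
  have h := affDim_inter_add_conflicts hab hab' hp hp'
  have hne : (Set.Icc a b ∩ Set.Icc a' b').Nonempty := ⟨p, hp, hp'⟩
  simp only [Neighborly, hne, true_and]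
  omega

/-- A family of pairwise `k`-neighborly boxes is encoded by words with between `1` and `k`
pairwise conflicts. -/
theorem exists_words_of_isNeighborlyFamily {k d : ℕ} {F : Finset (Set (Fin d → ℝ))}
    (hF : IsNeighborlyFamily k d F) :
    ∃ W : F → Fin d → Option Bool, ∀ A B, A ≠ B →
      1 ≤ conflicts (W A) (W B) ∧ conflicts (W A) (W B) ≤ k := by
  classical
  obtain ⟨hbox, hpair⟩ := hF
  choose! a b hab hA using hbox
  rcases F.eq_empty_or_nonempty with rfl | hne
  · exact ⟨fun _ _ => none, fun A => absurd A.2 (Finset.notMem_empty _)⟩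
  -- Helly's theorem for intervals, coordinate by coordinate: the largest left end is a common
  -- point.
  have hcross : ∀ A ∈ F, ∀ B ∈ F, a A ≤ b B := by
    intro A hAF B hBF
    by_cases h : A = B
    · subst h; exact fun i => (hab A hAF i).le
    · obtain ⟨x, hxA, hxB⟩ := (hpair A hAF B hBF h).1
      rw [hA A hAF] at hxA
      rw [hA B hBF] at hxB
      exact hxA.1.trans hxB.2
  have hmem : ∀ A ∈ F, F.sup' hne a ∈ Set.Icc (a A) (b A) := fun A hAF =>
    ⟨Finset.le_sup' a hAF, Finset.sup'_le hne a fun B hBF => hcross B hBF A hAF⟩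
  refine ⟨fun A => wordAt (F.sup' hne a) (a A) (b A), fun A B hAB => ?_⟩
  rw [← neighborly_iff_conflicts (hab A A.2) (hab B B.2) (hmem A A.2) (hmem B B.2),
    ← hA A A.2, ← hA B B.2]
  exact hpair A A.2 B B.2 fun h => hAB (Subtype.ext h)

/-- Words with between `1` and `k` pairwise conflicts yield pairwise `k`-neighborly boxes. -/
theorem card_mem_sizes_of_words {k d : ℕ} {ι : Type*} [Fintype ι] (W : ι → Fin d → Option Bool)
    (hW : ∀ i j, i ≠ j → 1 ≤ conflicts (W i) (W j) ∧ conflicts (W i) (W j) ≤ k) :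
    Fintype.card ι ∈ sizes k d := by
  classical
  -- The letters become the sides [0,1], [-1,0] and, for a star, [-1,1]; the origin is the common
  -- point.
  let a : ι → Fin d → ℝ := fun i t => if W i t = some true then 0 else -1
  let b : ι → Fin d → ℝ := fun i t => if W i t = some false then 0 else 1
  have hab : ∀ i t, a i t < b i t := by
    intro i t
    simp only [a, b]
    split_ifs <;> simp_all
  have hmem : ∀ i, (0 : Fin d → ℝ) ∈ Set.Icc (a i) (b i) := by
    refine fun i => ⟨fun t => ?_, fun t => ?_⟩
    · simp only [a]; split_ifs <;> simp
    · simp only [b]; split_ifs <;> simp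
  have hword : ∀ i, wordAt 0 (a i) (b i) = W i := by
    intro i
    ext1 t
    rcases h : W i t with _ | _ | _ <;> simp [wordAt, a, b, h]
  have hnb : ∀ i j, i ≠ j → Neighborly k (Set.Icc (a i) (b i)) (Set.Icc (a j) (b j)) := by
    intro i j hij
    rw [neighborly_iff_conflicts (hab i) (hab j) (hmem i) (hmem j), hword, hword]
    exact hW i j hij
  have hinj : Function.Injective fun i => Set.Icc (a i) (b i) := by
    intro i j hij
    by_contra hne
    have h0 := (hW i j hne).1
    have hle : ∀ l, a l ≤ b l := fun l t => (hab l t).le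
    obtain ⟨h1, h2⟩ := (Set.Icc_eq_Icc_iff (hle i)).1 hij
    rw [← hword i, ← hword j, h1, h2] at h0
    obtain ⟨t, ht⟩ := Finset.card_pos.1 h0
    obtain ⟨c, hc, hc'⟩ := (Finset.mem_filter.1 ht).2
    rw [hc] at hc'
    cases c <;> simp at hc'
  refine ⟨Finset.univ.image fun i => Set.Icc (a i) (b i), ⟨?_, ?_⟩, ?_⟩
  · intro A hA
    obtain ⟨i, -, rfl⟩ := Finset.mem_image.1 hA
    exact ⟨a i, b i, hab i, rfl⟩
  · intro A hA B hB hne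
    obtain ⟨i, -, rfl⟩ := Finset.mem_image.1 hA
    obtain ⟨j, -, rfl⟩ := Finset.mem_image.1 hB
    exact hnb i j fun h => hne (by rw [h])
  · rw [Finset.card_image_of_injective _ hinj, Finset.card_univ]

/-! ### Upper bound: mass on antipodal pairs. -/

/-- The number of stars of a word over `{0, 1, *}`. -/
def stars {d : ℕ} (u : Fin d → Option Bool) : ℕ :=
  (Finset.univ.filter fun i => u i = none).card

/-- The points of the discrete cube that match a word. -/
def subcube {d : ℕ} (u : Fin d → Option Bool) : Finset (Fin d → Bool) :=
  Fintype.piFinset fun i => (u i).elim Finset.univ fun c => {c}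

theorem mem_subcube {d : ℕ} {u : Fin d → Option Bool} {x : Fin d → Bool} :
    x ∈ subcube u ↔ ∀ i c, u i = some c → x i = c := by
  rw [subcube, Fintype.mem_piFinset]
  refine forall_congr' fun i => ?_
  rcases u i with _ | c <;> simp

theorem card_subcube {d : ℕ} (u : Fin d → Option Bool) : (subcube u).card = 2 ^ stars u := by
  rw [subcube, Fintype.card_piFinset, stars, ← Finset.prod_const, Finset.prod_filter]
  refine Finset.prod_congr rfl fun i _ => ?_
  rcases u i with _ | c <;> simp

theorem conflicts_eq_zero_of_mem_subcube {d : ℕ} {u v : Fin d → Option Bool} {x : Fin d → Bool}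
    (hu : x ∈ subcube u) (hv : x ∈ subcube v) : conflicts u v = 0 := by
  rw [conflicts, Finset.card_eq_zero, Finset.filter_eq_empty_iff]
  rintro i - ⟨c, h1, h2⟩
  have := (mem_subcube.1 hu i c h1).symm.trans (mem_subcube.1 hv i _ h2)
  cases c <;> simp at this

/-- A coordinate starred in neither word is a conflict, because antipodal points differ there. -/
theorem le_conflicts_add_stars {d : ℕ} {u v : Fin d → Option Bool} {x : Fin d → Bool}
    (hu : x ∈ subcube u) (hv : (fun i => !x i) ∈ subcube v) :
    d ≤ conflicts u v + (stars u + stars v) := by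
  classical
  have hcover : (Finset.univ : Finset (Fin d)) ⊆
      (Finset.univ.filter fun i => ∃ c, u i = some c ∧ v i = some (!c)) ∪
      ((Finset.univ.filter fun i => u i = none) ∪ Finset.univ.filter fun i => v i = none) := by
    intro i _
    have h1 := mem_subcube.1 hu i
    have h2 := mem_subcube.1 hv i
    simp only [Finset.mem_union, Finset.mem_filter, Finset.mem_univ, true_and]
    rcases hui : u i with _ | c
    · simp
    rcases hvi : v i with _ | c'
    · simp
    have h3 := h1 c hui
    have h4 := h2 c' hvi
    left
    exact ⟨c, rfl, by rw [← h4, h3]⟩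
  have h := Finset.card_le_card hcover
  rw [Finset.card_univ, Fintype.card_fin] at h
  refine h.trans ((Finset.card_union_le _ _).trans ?_)
  exact Nat.add_le_add_left (Finset.card_union_le _ _) _

/-- With a = 2^(-j) and b = 2^(-l), (1 - a)(1 - b) ≥ 0 gives a + b ≤ 1 + ab. -/
theorem half_pow_add_half_pow_le {s j l : ℕ} (h : s ≤ j + l) :
    (1 / 2 : ℝ) ^ j + (1 / 2) ^ l ≤ 1 + (1 / 2) ^ s := by
  have h1 : (1 / 2 : ℝ) ^ j ≤ 1 := pow_le_one₀ (by norm_num) (by norm_num)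
  have h2 : (1 / 2 : ℝ) ^ l ≤ 1 := pow_le_one₀ (by norm_num) (by norm_num)
  have h3 : (1 / 2 : ℝ) ^ (j + l) ≤ (1 / 2) ^ s :=
    pow_le_pow_of_le_one (by norm_num) (by norm_num) h
  rw [pow_add] at h3
  nlinarith [mul_nonneg (sub_nonneg.2 h1) (sub_nonneg.2 h2)]

/-- Volume bound: antipodal points of the discrete cube lie in subcubes with at least `s` stars
altogether. -/
theorem card_words_le {d s : ℕ} (hs : s ≤ d) {ι : Type*} [Fintype ι] (W : ι → Fin d → Option Bool)
    (hW : ∀ i j, i ≠ j → 1 ≤ conflicts (W i) (W j) ∧ conflicts (W i) (W j) ≤ d - s) :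
    (Fintype.card ι : ℝ) ≤ (1 / 2 + 1 / 2 ^ (s + 1)) * 2 ^ d := by
  classical
  -- Each word spreads unit mass evenly over its subcube, so the total mass counts the words.
  let g : (Fin d → Bool) → ℝ := fun x =>
    ∑ i, if x ∈ subcube (W i) then (1 / 2 : ℝ) ^ stars (W i) else 0
  have hgsum : ∑ x, g x = Fintype.card ι := by
    simp only [g]
    rw [Finset.sum_comm]
    have : ∀ i, (∑ x, if x ∈ subcube (W i) then (1 / 2 : ℝ) ^ stars (W i) else 0) = 1 := by
      intro i
      rw [Finset.sum_ite_mem, Finset.univ_inter, Finset.sum_const, card_subcube, nsmul_eq_mul]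
      push_cast
      rw [← mul_pow]
      norm_num
    rw [Finset.sum_congr rfl fun i _ => this i]
    simp
  have hg : ∀ x i, x ∈ subcube (W i) → g x = (1 / 2 : ℝ) ^ stars (W i) := by
    intro x i hi
    simp only [g]
    rw [Finset.sum_eq_single i, if_pos hi]
    · intro j _ hji
      rw [if_neg]
      intro hj
      have := (hW j i hji).1
      rw [conflicts_eq_zero_of_mem_subcube hj hi] at this
      omega
    · simp
  have hg0 : ∀ x, (∀ i, x ∉ subcube (W i)) → g x = 0 := fun x hx => by simp [g, hx]
  have hpos : (0 : ℝ) < (1 / 2) ^ s := by positivity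
  have hle1 : ∀ x, g x ≤ 1 := by
    intro x
    by_cases hx : ∃ i, x ∈ subcube (W i)
    · obtain ⟨i, hi⟩ := hx
      rw [hg x i hi]
      exact pow_le_one₀ (by norm_num) (by norm_num)
    · push Not at hx
      rw [hg0 x hx]
      exact zero_le_one
  have hpair : ∀ x, g x + g (fun i => !x i) ≤ 1 + (1 / 2) ^ s := by
    intro x
    by_cases hx : ∃ i, x ∈ subcube (W i)
    · by_cases hy : ∃ j, (fun i => !x i) ∈ subcube (W j)
      · obtain ⟨i, hi⟩ := hx
        obtain ⟨j, hj⟩ := hy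
        rw [hg _ i hi, hg _ j hj]
        apply half_pow_add_half_pow_le
        have h := le_conflicts_add_stars hi hj
        -- When `i = j` the bound `hW` says nothing, but a word has no conflict with itself and `s ≤
        -- d` suffices.
        by_cases hij : i = j
        · subst hij
          rw [conflicts_eq_zero_of_mem_subcube hi hi] at h
          omega
        · have := (hW i j hij).2
          omega
      · push Not at hy
        rw [hg0 _ hy]
        linarith [hle1 x]
    · push Not at hx
      rw [hg0 x hx]
      linarith [hle1 fun i => !x i]
  have hanti : ∑ x : Fin d → Bool, g (fun i => !x i) = ∑ x, g x :=
    Equiv.sum_comp ((Equiv.refl (Fin d)).arrowCongr Equiv.boolNot) g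
  have hsum : ∑ x : Fin d → Bool, (g x + g (fun i => !x i)) ≤
      ∑ _x : Fin d → Bool, (1 + (1 / 2 : ℝ) ^ s) := Finset.sum_le_sum fun x _ => hpair x
  rw [Finset.sum_add_distrib, hanti, hgsum, Finset.sum_const, nsmul_eq_mul] at hsum
  simp only [Finset.card_univ, Fintype.card_pi, Fintype.card_bool, Finset.prod_const,
    Fintype.card_fin, Nat.cast_pow, Nat.cast_ofNat] at hsum
  rw [one_div_pow] at hsum
  have : (1 / 2 + 1 / 2 ^ (s + 1) : ℝ) * 2 ^ d = (2 ^ d * (1 + 1 / 2 ^ s)) / 2 := by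
    rw [pow_succ]
    field_simp
  rw [this]
  linarith

theorem le_of_mem_sizes {d s m : ℕ} (hs : s ≤ d) (hm : m ∈ sizes (d - s) d) :
    (m : ℝ) ≤ (1 / 2 + 1 / 2 ^ (s + 1)) * 2 ^ d := by
  obtain ⟨F, hF, rfl⟩ := hm
  obtain ⟨W, hW⟩ := exists_words_of_isNeighborlyFamily hF
  simpa using card_words_le hs W hW

/-- The volume bound makes `sSup` a genuine maximum; on an unbounded set of naturals it would
default to 0. -/
theorem isGreatest_sizes {d s : ℕ} (hs : s ≤ d) : IsGreatest (sizes (d - s) d) (n (d - s) d) := by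
  have hne : (sizes (d - s) d).Nonempty := ⟨0, ∅, ⟨by simp, by simp⟩, rfl⟩
  have hbdd : BddAbove (sizes (d - s) d) :=
    ⟨⌊(1 / 2 + 1 / 2 ^ (s + 1) : ℝ) * 2 ^ d⌋₊, fun m hm => Nat.le_floor (le_of_mem_sizes hs hm)⟩
  exact ⟨Nat.sSup_mem hne hbdd, fun m hm => le_csSup hbdd hm⟩

/-! ### Lower bound: a ball and the subcubes outside it. -/

/-- The word with stars on `T` and the indicator function of `y` elsewhere. -/
def starWord {d : ℕ} (T y : Finset (Fin d)) (i : Fin d) : Option Bool :=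
  if i ∈ T then none else some (decide (i ∈ y))

theorem conflicts_starWord {d : ℕ} (T y T' y' : Finset (Fin d)) :
    conflicts (starWord T y) (starWord T' y') = (symmDiff y y' \ (T ∪ T')).card := by
  rw [conflicts]
  congr 1
  ext i
  simp only [starWord, Bool.exists_bool, Finset.mem_filter, Finset.mem_univ, true_and,
    Finset.mem_sdiff, Finset.mem_symmDiff, Finset.mem_union]
  split_ifs <;> simp <;> grind

theorem card_sub_lt_eq_card_lt {α : Type*} [DecidableEq α] (U : Finset α) {t : ℕ}
    (ht : t ≤ U.card) :
    (U.powerset.filter fun y => U.card - t < y.card).card =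
      (U.powerset.filter fun y => y.card < t).card := by
  refine Finset.card_bij' (fun y _ => U \ y) (fun y _ => U \ y) ?_ ?_ ?_ ?_
  · intro y hy
    simp only [Finset.mem_filter, Finset.mem_powerset] at hy ⊢
    have h := Finset.card_sdiff_add_card_eq_card hy.1
    exact ⟨Finset.sdiff_subset, by omega⟩
  · intro y hy
    simp only [Finset.mem_filter, Finset.mem_powerset] at hy ⊢
    have h := Finset.card_sdiff_add_card_eq_card hy.1
    exact ⟨Finset.sdiff_subset, by omega⟩
  · intro y hy
    exact Finset.sdiff_sdiff_eq_self (Finset.mem_powerset.1 (Finset.mem_filter.1 hy).1)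
  · intro y hy
    exact Finset.sdiff_sdiff_eq_self (Finset.mem_powerset.1 (Finset.mem_filter.1 hy).1)

/-- Up to a few middle layers, the sets of size less than `t` make up half of a power set. -/
theorem two_pow_card_le {α : Type*} [DecidableEq α] (U : Finset α) {t : ℕ} (ht : t ≤ U.card) :
    2 ^ U.card ≤ 2 * (U.powerset.filter fun y => y.card < t).card +
      (U.card + 1 - 2 * t) * U.card.choose (U.card / 2) := by
  -- The layers from `t` to `U.card - t` are each at most the middle one; by complementation the
  -- layers above them match those below.
  have hmid : ((Finset.Icc t (U.card - t)).biUnion fun j => U.powersetCard j).card ≤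
      (U.card + 1 - 2 * t) * U.card.choose (U.card / 2) := by
    refine (Finset.card_biUnion_le_card_mul _ _ (U.card.choose (U.card / 2)) fun j _ => ?_).trans ?_
    · rw [Finset.card_powersetCard]
      exact Nat.choose_le_middle _ _
    · refine Nat.mul_le_mul_right _ ?_
      rw [Nat.card_Icc]
      omega
  have hcover : U.powerset ⊆ (U.powerset.filter fun y => y.card < t) ∪
      ((U.powerset.filter fun y => U.card - t < y.card) ∪
        (Finset.Icc t (U.card - t)).biUnion fun j => U.powersetCard j) := by
    intro y hy
    have hyU := Finset.mem_powerset.1 hy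
    simp only [Finset.mem_union, Finset.mem_filter, Finset.mem_biUnion, Finset.mem_Icc,
      Finset.mem_powersetCard, Finset.mem_powerset, hyU, true_and]
    by_cases h1 : y.card < t
    · exact Or.inl h1
    by_cases h2 : U.card - t < y.card
    · exact Or.inr (Or.inl h2)
    · exact Or.inr (Or.inr ⟨y.card, ⟨by omega, by omega⟩, rfl⟩)
  have h := (Finset.card_le_card hcover).trans (Finset.card_union_le _ _)
  have h' := Finset.card_union_le (U.powerset.filter fun y => U.card - t < y.card)
    ((Finset.Icc t (U.card - t)).biUnion fun j => U.powersetCard j)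
  rw [card_sub_lt_eq_card_lt U ht] at h'
  rw [Finset.card_powerset] at h
  omega

/-- A ball of radius `r` with `2 * r ≤ d - s`, together with the subcubes in `s` fixed directions
that lie outside of it. -/
theorem card_ball_add_card_mem_sizes {d r : ℕ} (T : Finset (Fin d)) (hr : 2 * r ≤ d - T.card) :
    (Finset.univ.powerset.filter fun y : Finset (Fin d) => y.card < r + 1).card +
      (Tᶜ.powerset.filter fun y => r < y.card).card ∈ sizes (d - T.card) d := by
  classical
  set S := Finset.univ.powerset.filter fun y : Finset (Fin d) => y.card < r + 1
  set S' := Tᶜ.powerset.filter fun y => r < y.card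
  have hS : ∀ y : S, y.1.card ≤ r := fun y => by
    have := (Finset.mem_filter.1 y.2).2
    omega
  have hS' : ∀ y : S', y.1 ⊆ Tᶜ ∧ r < y.1.card := fun y =>
    ⟨Finset.mem_powerset.1 (Finset.mem_filter.1 y.2).1, (Finset.mem_filter.1 y.2).2⟩
  have hTle : ∀ u T' : Finset (Fin d), T ⊆ T' → (u \ T').card ≤ d - T.card := by
    intro u T' hT'
    have h : u \ T' ⊆ Tᶜ := fun i hi => by
      simp only [Finset.mem_sdiff] at hi
      exact Finset.mem_compl.2 fun h => hi.2 (hT' h)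
    simpa [Finset.card_compl] using Finset.card_le_card h
  have hmixed : ∀ (x : S) (y : S'),
      1 ≤ conflicts (starWord ∅ x.1) (starWord T y.1) ∧
      conflicts (starWord ∅ x.1) (starWord T y.1) ≤ d - T.card := by
    intro x y
    rw [conflicts_starWord]
    refine ⟨Finset.card_pos.2 ?_, hTle _ _ Finset.subset_union_right⟩
    -- The larger set has an element outside the smaller one; it avoids `T`, so it is a conflict.
    have hlt : x.1.card < y.1.card := (hS x).trans_lt (hS' y).2
    obtain ⟨i, hiy, hix⟩ := Finset.exists_mem_notMem_of_card_lt_card hlt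
    have hiT := Finset.mem_compl.1 ((hS' y).1 hiy)
    exact ⟨i, by simp [Finset.mem_symmDiff, hiy, hix, hiT]⟩
  have hcomm : ∀ T₁ y₁ T₂ y₂ : Finset (Fin d), conflicts (starWord T₁ y₁) (starWord T₂ y₂) =
      conflicts (starWord T₂ y₂) (starWord T₁ y₁) := by
    intro T₁ y₁ T₂ y₂
    rw [conflicts_starWord, conflicts_starWord, symmDiff_comm, Finset.union_comm]
  have hcard : Fintype.card (S ⊕ S') = S.card + S'.card := by simp
  rw [← hcard]
  refine card_mem_sizes_of_words
    (Sum.elim (fun x : S => starWord ∅ x.1) (fun y : S' => starWord T y.1)) ?_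
  rintro (x | y) (x' | y') hne
  · have hxx : x.1 ≠ x'.1 := fun h => hne (by rw [Subtype.ext h])
    simp only [Sum.elim_inl, conflicts_starWord, Finset.union_empty, Finset.sdiff_empty]
    refine ⟨Finset.card_pos.2 (Finset.symmDiff_nonempty.2 hxx), ?_⟩
    have h : symmDiff x.1 x'.1 ⊆ x.1 ∪ x'.1 := symmDiff_le_sup
    have := (Finset.card_le_card h).trans (Finset.card_union_le _ _)
    have h1 := hS x
    have h2 := hS x'
    omega
  · exact hmixed x y'
  · simp only [Sum.elim_inl, Sum.elim_inr]
    rw [hcomm]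
    exact hmixed x' y
  · have hyy : y.1 ≠ y'.1 := fun h => hne (by rw [Subtype.ext h])
    simp only [Sum.elim_inr, conflicts_starWord]
    refine ⟨Finset.card_pos.2 ?_, hTle _ _ Finset.subset_union_right⟩
    obtain ⟨i, hi⟩ := Finset.symmDiff_nonempty.2 hyy
    refine ⟨i, ?_⟩
    have hiT : i ∉ T := by
      rcases Finset.mem_symmDiff.1 hi with h | h
      · exact Finset.mem_compl.1 ((hS' y).1 h.1)
      · exact Finset.mem_compl.1 ((hS' y').1 h.1)
    simp [hi, hiT]

theorem le_n_sub {s d : ℕ} (hs : s ≤ d) :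
    (1 / 2 + 1 / 2 ^ (s + 1)) * 2 ^ d - (s + 1) * (d.choose (d / 2) : ℝ) ≤ (n (d - s) d : ℝ) := by
  obtain ⟨T, -, hT⟩ := Finset.exists_subset_card_eq (s := (Finset.univ : Finset (Fin d)))
    (n := s) (by simpa using hs)
  have hTc : Tᶜ.card = d - s := by simp [Finset.card_compl, hT]
  -- This is the largest radius allowed by `2 * r ≤ d - s`.
  have hmem := card_ball_add_card_mem_sizes (r := (d - s) / 2) T (by omega)
  rw [hT] at hmem
  have hle := (isGreatest_sizes hs).2 hmem
  have hball : 2 ^ d ≤ 2 * (Finset.univ.powerset.filter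
      fun y : Finset (Fin d) => y.card < (d - s) / 2 + 1).card + (s + 1) * d.choose (d / 2) := by
    rcases Nat.eq_zero_or_pos d with rfl | hd
    · simp; omega
    by_cases hd1 : (d - s) / 2 + 1 ≤ d
    · have h := two_pow_card_le (Finset.univ : Finset (Fin d)) (t := (d - s) / 2 + 1)
        (by simpa using hd1)
      rw [Finset.card_univ, Fintype.card_fin] at h
      refine h.trans (Nat.add_le_add_left (Nat.mul_le_mul_right _ ?_) _)
      omega
    · omega
  have hup : 2 ^ (d - s) ≤ 2 * (Tᶜ.powerset.filter fun y => (d - s) / 2 < y.card).card +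
      d.choose (d / 2) := by
    -- This threshold makes the complementary layers those above `(d - s) / 2`; at most one middle
    -- layer, present when d - s is even, is left over.
    have ht : d - s - (d - s) / 2 ≤ Tᶜ.card := by omega
    have h := two_pow_card_le Tᶜ ht
    rw [← card_sub_lt_eq_card_lt Tᶜ ht, hTc,
      show d - s - (d - s - (d - s) / 2) = (d - s) / 2 by omega] at h
    refine h.trans (Nat.add_le_add_left ?_ _)
    have hch : (d - s).choose ((d - s) / 2) ≤ d.choose (d / 2) :=
      (Nat.choose_le_choose _ (Nat.sub_le _ _)).trans (Nat.choose_le_middle _ _)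
    calc _ ≤ 1 * (d - s).choose ((d - s) / 2) := Nat.mul_le_mul_right _ (by omega)
      _ ≤ _ := by simpa using hch
  have hle' : ((_ : ℕ) : ℝ) ≤ _ := Nat.cast_le.2 hle
  have hball' : ((_ : ℕ) : ℝ) ≤ _ := Nat.cast_le.2 hball
  have hup' : ((_ : ℕ) : ℝ) ≤ _ := Nat.cast_le.2 hup
  push_cast at hle' hball' hup'
  have hpow : (2 : ℝ) ^ d = 2 ^ (d - s) * 2 ^ s := by rw [← pow_add, Nat.sub_add_cancel hs]
  have hsplit : (1 / 2 + 1 / 2 ^ (s + 1)) * (2 : ℝ) ^ d = (2 ^ d + 2 ^ (d - s)) / 2 := by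
    rw [hpow, pow_succ]
    field_simp
  -- The halved errors add up to (s + 2)/2 middle binomials, which is at most s + 1 of them.
  have hc : (0 : ℝ) ≤ s * d.choose (d / 2) := by positivity
  rw [hsplit]
  linarith

/-! ### The middle binomial coefficient is o(2^d). -/

/-- The induction step squares the recurrence for `centralBinom` and uses (2m + 1)(2m + 3) ≤ (2m +
2)^2. -/
theorem centralBinom_sq_mul_le (m : ℕ) : m.centralBinom ^ 2 * (2 * m + 1) ≤ 16 ^ m := by
  induction m with
  | zero => simp
  | succ m ih =>
    have h := Nat.succ_mul_centralBinom_succ m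
    have hpos : 0 < (m + 1) ^ 2 := by positivity
    refine Nat.le_of_mul_le_mul_left ?_ hpos
    calc (m + 1) ^ 2 * ((m + 1).centralBinom ^ 2 * (2 * (m + 1) + 1))
        = ((m + 1) * (m + 1).centralBinom) ^ 2 * (2 * m + 3) := by ring
      _ = (m.centralBinom ^ 2 * (2 * m + 1)) * (4 * ((2 * m + 1) * (2 * m + 3))) := by
          rw [h]; ring
      _ ≤ 16 ^ m * (16 * (m + 1) ^ 2) := Nat.mul_le_mul ih (by nlinarith)
      _ = (m + 1) ^ 2 * 16 ^ (m + 1) := by ring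

theorem choose_half_sq_mul_le (d : ℕ) : d.choose (d / 2) ^ 2 * (d + 1) ≤ 4 ^ d := by
  obtain ⟨m, rfl | rfl⟩ := Nat.even_or_odd' d
  · rw [Nat.mul_div_cancel_left m two_pos, ← Nat.centralBinom_eq_two_mul_choose, pow_mul]
    exact centralBinom_sq_mul_le m
  · have hdiv : (2 * m + 1) / 2 = m := by omega
    -- For odd d the middle coefficient is half of the next central one.
    have hc : (m + 1).centralBinom = 2 * (2 * m + 1).choose m := by
      rw [Nat.centralBinom_eq_two_mul_choose, show 2 * (m + 1) = 2 * m + 1 + 1 by ring,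
        Nat.choose_succ_succ, Nat.choose_symm_half]
      ring
    have h := centralBinom_sq_mul_le (m + 1)
    rw [hc] at h
    have h4 : 4 ^ (2 * m + 1) = 4 * 16 ^ m := by rw [pow_succ, pow_mul]; ring
    rw [hdiv, h4]
    rw [pow_succ 16] at h
    nlinarith

theorem choose_half_isLittleO :
    (fun d : ℕ => (d.choose (d / 2) : ℝ)) =o[atTop] fun d : ℕ => (2 : ℝ) ^ d := by
  rw [isLittleO_iff_tendsto fun d h => absurd h (by positivity)]
  have hlim : Tendsto (fun d : ℕ => Real.sqrt (1 / ((d : ℝ) + 1))) atTop (𝓝 0) := by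
    have h := (Real.continuous_sqrt.tendsto 0).comp
      (tendsto_one_div_add_atTop_nhds_zero_nat (𝕜 := ℝ))
    rwa [Real.sqrt_zero] at h
  refine squeeze_zero (fun d => by positivity) (fun d => ?_) hlim
  apply Real.le_sqrt_of_sq_le
  have h : ((d.choose (d / 2) ^ 2 * (d + 1) : ℕ) : ℝ) ≤ ((4 ^ d : ℕ) : ℝ) :=
    Nat.cast_le.2 (choose_half_sq_mul_le d)
  push_cast at h
  have h4 : ((2 : ℝ) ^ d) ^ 2 = 4 ^ d := by rw [← pow_mul, mul_comm, pow_mul]; norm_num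
  rw [div_pow, h4, div_le_div_iff₀ (by positivity) (by positivity)]
  linarith

end NeighborlyBoxes

/-! ### The bounds and the limit. -/

theorem theorem2 :
    (∀ s d : ℕ, 1 ≤ s → 2 * s ≤ d →
      IsGreatest (NeighborlyBoxes.sizes (d - s) d) (NeighborlyBoxes.n (d - s) d) ∧
      (NeighborlyBoxes.n (d - s) d : ℝ) ≤ (1 / 2 + 1 / 2 ^ (s + 1)) * 2 ^ d) ∧
    (∀ s : ℕ, 1 ≤ s →
      ∃ e : ℕ → ℝ, e =o[atTop] (fun d : ℕ => (2 : ℝ) ^ d) ∧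
        ∀ d : ℕ, 2 * s ≤ d →
          (1 / 2 + 1 / 2 ^ (s + 1)) * 2 ^ d - e d ≤ (NeighborlyBoxes.n (d - s) d : ℝ)) ∧
    (∀ s : ℕ, 1 ≤ s →
      Tendsto (fun d : ℕ => (NeighborlyBoxes.n (d - s) d : ℝ) / 2 ^ d) atTop
        (𝓝 ((2 ^ s + 1) / 2 ^ (s + 1)))) := by
  have hupper : ∀ s d : ℕ, s ≤ d →
      (NeighborlyBoxes.n (d - s) d : ℝ) ≤ (1 / 2 + 1 / 2 ^ (s + 1)) * 2 ^ d := fun s d hs =>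
    NeighborlyBoxes.le_of_mem_sizes hs (NeighborlyBoxes.isGreatest_sizes hs).1
  have herr : ∀ s : ℕ, (fun d : ℕ => ((s : ℝ) + 1) * (d.choose (d / 2) : ℝ)) =o[atTop]
      fun d : ℕ => (2 : ℝ) ^ d := fun s =>
    NeighborlyBoxes.choose_half_isLittleO.const_mul_left _
  refine ⟨fun s d _ hd => ⟨NeighborlyBoxes.isGreatest_sizes (by omega), hupper s d (by omega)⟩,
    fun s _ => ⟨_, herr s, fun d hd => NeighborlyBoxes.le_n_sub (by omega)⟩, fun s _ => ?_⟩
  have hc : ((2 : ℝ) ^ s + 1) / 2 ^ (s + 1) = 1 / 2 + 1 / 2 ^ (s + 1) := by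
    rw [pow_succ]
    field_simp
  rw [hc]
  have hlow := (herr s).tendsto_div_nhds_zero.const_sub (1 / 2 + 1 / 2 ^ (s + 1) : ℝ)
  rw [sub_zero] at hlow
  refine tendsto_of_tendsto_of_tendsto_of_le_of_le' hlow tendsto_const_nhds ?_ ?_
  · filter_upwards [eventually_ge_atTop s] with d hd
    rw [le_div_iff₀ (by positivity), sub_mul, div_mul_cancel₀ _ (by positivity)]
    exact NeighborlyBoxes.le_n_sub hd
  · filter_upwards [eventually_ge_atTop s] with d hd
    rw [div_le_iff₀ (by positivity)]
    exact hupper s d hd
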